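/- Let $\lambda=(\lambda_n)_{n\ge1}$ be a frequency, i.e. a strictly increasing sequence of nonnegative real numbers tending to $+\infty$. A $\lambda$-Dirichlet group is a pair $(G,\beta)$ where $G$ is a compact (Hausdorff) abelian group and $\beta:(\mathbb R,+)\to G$ is a continuous homomorphism with dense range such that for every $n\ge1$ there is a (unique) character $h_{\lambda_n}\in\widehat G$ with $h_{\lambda_n}(\beta(t))=e^{-i\lambda_n t}$ for all $t\in\mathbb R$. Let $H_\infty^\lambda(G)$ be the space of all $f\in L^\infty(G)$ (with respect to normalized Haar measure) whose Fourier coefficients $\widehat f(\chi)$ vanish for all $\chi\in\widehat G\setminus\{h_{\lambda_n}:n\ge1\}$, and let $\mathcal H_\infty(\lambda)$ be the space of all formal Dirichlet series $\sum_{n\ge1}\widehat f(h_{\lambda_n})e^{-\lambda_n s}$, $f\in H^\lambda_\infty(G)$, normed by $\|f\|_\infty$. Let $\mathcal D_\infty(\lambda)$ be the space of all Dirichlet series $D=\sum_{n\ge1} a_ne^{-\lambda_ns}$ which converge on $[\mathrm{Re}\,s>0]$ to a bounded holomorphic function, with norm $\sup_{\mathrm{Re}\,s>0}|D(s)|$.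 Let $S_N:\mathcal H_\infty(\lambda)\to\mathcal D_\infty(\lambda)$, $\sum_{n\ge1}a_ne^{-\lambda_ns}\mapsto\sum_{n=1}^Na_ne^{-\lambda_ns}$. Theorem. For every frequency $\lambda$ there exists $C>0$ (independent of the choice of the $\lambda$-Dirichlet group) such that, for all integers $M>N\ge1$, $$\|S_N\|_{\mathcal H_\infty(\lambda)\to\mathcal D_\infty(\lambda)}\le C\left(\log\left(\frac{\lambda_M+\lambda_N}{\lambda_M-\lambda_N}\right)+(M-N-1)+1\right).$$ -/

import Mathlib

open MeasureTheory Filter Topology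

universe u

namespace GeneralDirichlet

/-- A frequency: a (strictly) increasing sequence `λ₁ < λ₂ < ...` of nonnegative real numbers
tending to `+∞`. -/
structure Frequency where
  /-- The `n`-th term `λ_n`, `n ≥ 1`. -/
  val : ℕ+ → ℝ
  nonneg : ∀ n, 0 ≤ val n
  strictMono : StrictMono val
  tendsto_atTop : Tendsto val atTop atTop

instance : CoeFun Frequency (fun _ => ℕ+ → ℝ) := ⟨Frequency.val⟩

/-- The open right half-plane `ℂ₀ = [Re s > 0]`. -/
def rightHalfPlane : Set ℂ := {s : ℂ | 0 < s.re}

/-- The formal Dirichlet series `∑ a_n e^{-λ_n s}` is given by its sequence of coefficients `a`;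
this is the value at `s` of the sum of its first `N` terms. -/
noncomputable def evalPartial (lam : Frequency) (a : ℕ+ → ℂ) (N : ℕ+) (s : ℂ) : ℂ :=
  ∑ n ∈ Finset.Icc 1 N, a n * Complex.exp (-(lam n : ℂ) * s)

/-- The sum `∑ a_n e^{-λ_n s}`, i.e. the limit of the partial sums (used only where the series
converges). -/
noncomputable def evalSum (lam : Frequency) (a : ℕ+ → ℂ) (s : ℂ) : ℂ :=
  limUnder atTop (fun N : ℕ+ => evalPartial lam a N s)

theorem evalSum_eq {lam : Frequency} {a : ℕ+ → ℂ} {s z : ℂ}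
    (h : Tendsto (fun N : ℕ+ => evalPartial lam a N s) atTop (𝓝 z)) :
    evalSum lam a s = z := h.limUnder_eq

theorem evalPartial_add (lam : Frequency) (a b : ℕ+ → ℂ) (N : ℕ+) (s : ℂ) :
    evalPartial lam (a + b) N s = evalPartial lam a N s + evalPartial lam b N s := by
  simp [evalPartial, add_mul, Finset.sum_add_distrib]

theorem evalPartial_smul (lam : Frequency) (c : ℂ) (a : ℕ+ → ℂ) (N : ℕ+) (s : ℂ) :
    evalPartial lam (c • a) N s = c * evalPartial lam a N s := by
  simp [evalPartial, Finset.mul_sum, mul_assoc]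

/-- The `λ`-Dirichlet series which converge on `ℂ₀`, to a bounded holomorphic function there. -/
def dInftySubmodule (lam : Frequency) : Submodule ℂ (ℕ+ → ℂ) where
  carrier := {a | ∃ f : ℂ → ℂ, DifferentiableOn ℂ f rightHalfPlane ∧
    (∃ K : ℝ, ∀ s ∈ rightHalfPlane, ‖f s‖ ≤ K) ∧
    ∀ s ∈ rightHalfPlane, Tendsto (fun N : ℕ+ => evalPartial lam a N s) atTop (𝓝 (f s))}
  add_mem' := by
    rintro a b ⟨f, hf, ⟨K, hK⟩, hfa⟩ ⟨g, hg, ⟨L, hL⟩, hgb⟩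
    refine ⟨fun s => f s + g s, hf.add hg, ⟨K + L, fun s hs => ?_⟩, fun s hs => ?_⟩
    · exact (norm_add_le _ _).trans (add_le_add (hK s hs) (hL s hs))
    · simpa only [evalPartial_add] using (hfa s hs).add (hgb s hs)
  zero_mem' := by
    refine ⟨fun _ => 0, differentiableOn_const 0, ⟨0, by simp⟩, fun s _ => ?_⟩
    simp [evalPartial]
  smul_mem' := by
    rintro c a ⟨f, hf, ⟨K, hK⟩, hfa⟩
    refine ⟨fun s => c * f s, hf.const_mul c, ⟨‖c‖ * K, fun s hs => ?_⟩, fun s hs => ?_⟩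
    · rw [norm_mul]
      exact mul_le_mul_of_nonneg_left (hK s hs) (norm_nonneg c)
    · simpa only [evalPartial_smul] using (hfa s hs).const_mul c

/-- The space `𝓓_∞(λ)`. It is a type of its own, so that it carries the topology of its norm and
not that of coefficientwise convergence. -/
def DInfty (lam : Frequency) : Type := ↥(dInftySubmodule lam)

namespace DInfty

variable {lam : Frequency}

noncomputable instance : AddCommGroup (DInfty lam) :=
  inferInstanceAs (AddCommGroup ↥(dInftySubmodule lam))

noncomputable instance : Module ℂ (DInfty lam) :=
  inferInstanceAs (Module ℂ ↥(dInftySubmodule lam))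

/-- The coefficients of a series in `𝓓_∞(λ)`. -/
def coeff (D : DInfty lam) : ℕ+ → ℂ := D.1

theorem coeff_add (D E : DInfty lam) : (D + E).coeff = D.coeff + E.coeff := rfl

theorem coeff_smul (c : ℂ) (D : DInfty lam) : (c • D).coeff = c • D.coeff := rfl

theorem tendsto_evalSum (D : DInfty lam) {s : ℂ} (hs : s ∈ rightHalfPlane) :
    Tendsto (fun N : ℕ+ => evalPartial lam D.coeff N s) atTop (𝓝 (evalSum lam D.coeff s)) := by
  obtain ⟨f, -, -, h⟩ := D.2
  have h' := h s hs
  rwa [← evalSum_eq h'] at h'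

/-- The norm `‖D‖_∞ = sup_{Re s > 0} |D(s)|`. -/
noncomputable instance : Norm (DInfty lam) :=
  ⟨fun D => ⨆ s : rightHalfPlane, ‖evalSum lam D.coeff s‖⟩

theorem norm_def (D : DInfty lam) :
    ‖D‖ = ⨆ s : rightHalfPlane, ‖evalSum lam D.coeff s‖ := rfl

theorem bddAbove (D : DInfty lam) :
    BddAbove (Set.range fun s : rightHalfPlane => ‖evalSum lam D.coeff s‖) := by
  obtain ⟨f, -, ⟨K, hK⟩, h⟩ := D.2
  refine ⟨K, ?_⟩
  rintro _ ⟨s, rfl⟩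
  have : evalSum lam D.coeff s = f s := evalSum_eq (h s s.2)
  simpa only [this] using hK s s.2

instance : Nonempty rightHalfPlane := ⟨⟨1, by simp [rightHalfPlane]⟩⟩

theorem evalSum_add (D E : DInfty lam) (s : rightHalfPlane) :
    evalSum lam (D + E).coeff s = evalSum lam D.coeff s + evalSum lam E.coeff s := by
  refine evalSum_eq ?_
  simpa only [coeff_add, evalPartial_add] using
    (D.tendsto_evalSum s.2).add (E.tendsto_evalSum s.2)

theorem evalSum_smul (c : ℂ) (D : DInfty lam) (s : rightHalfPlane) :
    evalSum lam (c • D).coeff s = c * evalSum lam D.coeff s := by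
  refine evalSum_eq ?_
  simpa only [coeff_smul, evalPartial_smul] using (D.tendsto_evalSum s.2).const_mul c

theorem seminormCore : SeminormedSpace.Core ℂ (DInfty lam) where
  norm_nonneg D := Real.iSup_nonneg fun _ => norm_nonneg _
  norm_smul c D := by
    simp only [norm_def, evalSum_smul, norm_mul]
    exact (Real.mul_iSup_of_nonneg (norm_nonneg c) _).symm
  norm_triangle D E := by
    refine ciSup_le fun s => ?_
    rw [evalSum_add]
    exact (norm_add_le _ _).trans
      (add_le_add (le_ciSup D.bddAbove s) (le_ciSup E.bddAbove s))

noncomputable instance : SeminormedAddCommGroup (DInfty lam) :=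
  SeminormedAddCommGroup.ofCore seminormCore

noncomputable instance : NormedSpace ℂ (DInfty lam) where
  norm_smul_le c D := (seminormCore.norm_smul c D).le

end DInfty

/-- The coefficients of the `N`-th partial sum of a formal Dirichlet series. -/
def truncate (N : ℕ+) (a : ℕ+ → ℂ) : ℕ+ → ℂ := fun n => if n ≤ N then a n else 0

theorem evalPartial_truncate (lam : Frequency) (a : ℕ+ → ℂ) {N K : ℕ+} (h : N ≤ K) (s : ℂ) :
    evalPartial lam (truncate N a) K s = evalPartial lam a N s := by
  unfold evalPartial truncate
  symm
  refine Finset.sum_subset_zero_on_sdiff (Finset.Icc_subset_Icc le_rfl h) ?_ ?_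
  · intro n hn
    have : ¬ n ≤ N := by simpa using (Finset.mem_sdiff.1 hn).2
    simp [this]
  · intro n hn
    simp [(Finset.mem_Icc.1 hn).2]

theorem tendsto_truncate (lam : Frequency) (a : ℕ+ → ℂ) (N : ℕ+) (s : ℂ) :
    Tendsto (fun K : ℕ+ => evalPartial lam (truncate N a) K s) atTop
      (𝓝 (evalPartial lam a N s)) :=
  tendsto_const_nhds.congr' <| (eventually_ge_atTop N).mono fun _ hK =>
    (evalPartial_truncate lam a hK s).symm

theorem norm_evalPartial_le (lam : Frequency) (a : ℕ+ → ℂ) (N : ℕ+) {s : ℂ}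
    (hs : s ∈ rightHalfPlane) :
    ‖evalPartial lam a N s‖ ≤ ∑ n ∈ Finset.Icc 1 N, ‖a n‖ := by
  refine (norm_sum_le _ _).trans (Finset.sum_le_sum fun n _ => ?_)
  rw [norm_mul, Complex.norm_exp]
  refine mul_le_of_le_one_right (norm_nonneg _) (Real.exp_le_one_iff.2 ?_)
  have h0 : 0 < s.re := hs
  have h1 := mul_nonneg (lam.nonneg n) h0.le
  simpa using h1

theorem truncate_mem (lam : Frequency) (a : ℕ+ → ℂ) (N : ℕ+) :
    truncate N a ∈ dInftySubmodule lam := by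
  refine ⟨evalPartial lam a N, ?_, ⟨_, fun s hs => norm_evalPartial_le lam a N hs⟩,
    fun s _ => tendsto_truncate lam a N s⟩
  unfold evalPartial
  fun_prop

section Group

variable (lam : Frequency) (G : Type u) [CommGroup G] [TopologicalSpace G]

/-- The structure of a `λ`-Dirichlet group on the compact abelian group `G`: a continuous
homomorphism `β : (ℝ, +) → G` with dense range such that every `e^{-i λ_n ·}` is of the form
`h ∘ β` for a character `h` of `G`. -/
structure DirichletGroup where
  /-- The homomorphism `(ℝ, +) → G`. -/
  β : Multiplicative ℝ →* G
  continuous_β : Continuous fun t : ℝ => β (Multiplicative.ofAdd t)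
  denseRange_β : DenseRange fun t : ℝ => β (Multiplicative.ofAdd t)
  exists_character : ∀ n : ℕ+, ∃ h : PontryaginDual G, ∀ t : ℝ,
    (h (β (Multiplicative.ofAdd t)) : ℂ) = Complex.exp (-Complex.I * (lam n : ℂ) * (t : ℂ))

variable {lam G}

/-- The character `h_{λ_n}` of `G`, determined by `h_{λ_n} ∘ β = e^{-i λ_n ·}`
(it is unique as `β` has dense range). -/
noncomputable def DirichletGroup.h (𝒢 : DirichletGroup lam G) (n : ℕ+) : PontryaginDual G :=
  (𝒢.exists_character n).choose

theorem DirichletGroup.h_apply_β (𝒢 : DirichletGroup lam G) (n : ℕ+) (t : ℝ) :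
    (𝒢.h n (𝒢.β (Multiplicative.ofAdd t)) : ℂ) =
      Complex.exp (-Complex.I * (lam n : ℂ) * (t : ℂ)) :=
  (𝒢.exists_character n).choose_spec t

variable [IsTopologicalGroup G] [CompactSpace G] [MeasurableSpace G] [BorelSpace G]

variable (G) in
/-- The normalized Haar measure of a compact group: the total mass is `1`. -/
noncomputable abbrev haarProb : Measure G :=
  Measure.haarMeasure (⊤ : TopologicalSpace.PositiveCompacts G)

/-- The Fourier coefficient `f̂(χ) = ∫_G f(x) conj(χ(x)) dx`. -/
noncomputable def fourierCoeffGroup (f : G → ℂ) (χ : PontryaginDual G) : ℂ :=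
  ∫ x, f x * (starRingEnd ℂ) (χ x : ℂ) ∂(haarProb G)

theorem integrable_mul_character (f : Lp ℂ ⊤ (haarProb G)) (χ : PontryaginDual G) :
    Integrable (fun x => f x * (starRingEnd ℂ) (χ x : ℂ)) (haarProb G) := by
  have hf : Integrable f (haarProb G) := (Lp.memLp f).integrable le_top
  have hc : Continuous fun x : G => (starRingEnd ℂ) (χ x : ℂ) :=
    Complex.continuous_conj.comp (continuous_subtype_val.comp (map_continuous χ))
  refine hf.mul_bdd (c := 1) hc.aestronglyMeasurable ?_
  refine Eventually.of_forall fun x => ?_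
  rw [RCLike.norm_conj]
  exact (Circle.norm_coe (χ x)).le

theorem fourierCoeffGroup_add (f g : Lp ℂ ⊤ (haarProb G)) (χ : PontryaginDual G) :
    fourierCoeffGroup (f + g : Lp ℂ ⊤ (haarProb G)) χ =
      fourierCoeffGroup f χ + fourierCoeffGroup g χ := by
  unfold fourierCoeffGroup
  rw [← integral_add (integrable_mul_character f χ) (integrable_mul_character g χ)]
  refine integral_congr_ae ?_
  filter_upwards [Lp.coeFn_add f g] with x hx
  rw [hx, Pi.add_apply, add_mul]

theorem fourierCoeffGroup_smul (c : ℂ) (f : Lp ℂ ⊤ (haarProb G)) (χ : PontryaginDual G) :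
    fourierCoeffGroup (c • f : Lp ℂ ⊤ (haarProb G)) χ = c * fourierCoeffGroup f χ := by
  unfold fourierCoeffGroup
  rw [← integral_const_mul]
  refine integral_congr_ae ?_
  filter_upwards [Lp.coeFn_smul c f] with x hx
  rw [hx, Pi.smul_apply, smul_eq_mul, mul_assoc]

theorem norm_fourierCoeffGroup_le (f : Lp ℂ ⊤ (haarProb G)) (χ : PontryaginDual G) :
    ‖fourierCoeffGroup f χ‖ ≤ ‖f‖ := by
  have h1 : haarProb G Set.univ = 1 := by
    simpa using Measure.haarMeasure_self (K₀ := (⊤ : TopologicalSpace.PositiveCompacts G))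
  have h := norm_integral_le_of_norm_le_const (μ := haarProb G) (C := ‖f‖)
    (f := fun x => f x * (starRingEnd ℂ) (χ x : ℂ)) ?_
  · simpa [fourierCoeffGroup, Measure.real, h1] using h
  · filter_upwards [ae_le_eLpNormEssSup (f := (f : G → ℂ)) (μ := haarProb G)] with x hx
    have hx' : ‖f x‖ ≤ ‖f‖ := by
      rw [Lp.norm_def, eLpNorm_exponent_top]
      have := ENNReal.toReal_mono
        (by simpa [eLpNorm_exponent_top] using Lp.eLpNorm_ne_top f) hx
      simpa using this
    rw [norm_mul, RCLike.norm_conj]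
    refine (mul_le_of_le_one_right (norm_nonneg _) ?_).trans hx'
    exact (Circle.norm_coe (χ x)).le

/-- The space `H_∞^λ(G)` of all `f ∈ L^∞(G)` whose Fourier transform is supported in
`{h_{λ_n} : n ≥ 1}`, with the norm of `L^∞(G)`. -/
noncomputable def HInftyGroup (𝒢 : DirichletGroup lam G) :
    Submodule ℂ (Lp ℂ ⊤ (haarProb G)) where
  carrier := {f | ∀ χ : PontryaginDual G, (∀ n, χ ≠ 𝒢.h n) → fourierCoeffGroup f χ = 0}
  add_mem' := by
    intro f g hf hg χ hχ
    rw [fourierCoeffGroup_add, hf χ hχ, hg χ hχ, add_zero]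
  zero_mem' := by
    intro χ _
    have h := fourierCoeffGroup_smul (0 : ℂ) (0 : Lp ℂ ⊤ (haarProb G)) χ
    rwa [zero_smul, zero_mul] at h
  smul_mem' := by
    intro c f hf χ hχ
    rw [fourierCoeffGroup_smul, hf χ hχ, mul_zero]

/-- The Bohr map `f ↦ ∑ f̂(h_{λ_n}) e^{-λ_n s}`. It identifies `H_∞^λ(G)` isometrically with the
space `𝓗_∞(λ)`, whose norm is by definition the one transported from `H_∞^λ(G)`. -/
noncomputable def bohr (𝒢 : DirichletGroup lam G) : HInftyGroup 𝒢 →ₗ[ℂ] (ℕ+ → ℂ) where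
  toFun f := fun n => fourierCoeffGroup (f : Lp ℂ ⊤ (haarProb G)) (𝒢.h n)
  map_add' _ _ := funext fun _ => fourierCoeffGroup_add _ _ _
  map_smul' _ _ := funext fun _ => fourierCoeffGroup_smul _ _ _

/-- The partial sum operator
`S_N : 𝓗_∞(λ) → 𝓓_∞(λ)`, `∑_{n ≥ 1} a_n e^{-λ_n s} ↦ ∑_{n=1}^N a_n e^{-λ_n s}`, where the series in
`𝓗_∞(λ)` are the images `bohr 𝒢 f` of the functions `f ∈ H_∞^λ(G)`, with the norm of `f`. -/
noncomputable def partialSumOp (𝒢 : DirichletGroup lam G) (N : ℕ+) :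
    HInftyGroup 𝒢 →L[ℂ] DInfty lam :=
  LinearMap.mkContinuous
    { toFun := fun f => (⟨truncate N (bohr 𝒢 f), truncate_mem lam _ N⟩ : DInfty lam)
      map_add' := fun f g => Subtype.ext <| funext fun n => by
        change truncate N (bohr 𝒢 (f + g)) n = truncate N (bohr 𝒢 f) n + truncate N (bohr 𝒢 g) n
        by_cases h : n ≤ N <;> simp [truncate, h]
      map_smul' := fun c f => Subtype.ext <| funext fun n => by
        change truncate N (bohr 𝒢 (c • f)) n = c • truncate N (bohr 𝒢 f) n
        by_cases h : n ≤ N <;> simp [truncate, h] }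
    (N : ℝ)
    (fun f => by
      refine ciSup_le fun s => ?_
      change ‖evalSum lam (truncate N (bohr 𝒢 f)) s‖ ≤ _
      rw [evalSum_eq (tendsto_truncate lam _ N s)]
      refine (norm_evalPartial_le lam _ N s.2).trans ?_
      refine (Finset.sum_le_card_nsmul _ _ ‖f‖ fun n _ =>
        norm_fourierCoeffGroup_le (f : Lp ℂ ⊤ (haarProb G)) (𝒢.h n)).trans ?_
      simp)

theorem coeff_partialSumOp (𝒢 : DirichletGroup lam G) (N : ℕ+) (f : HInftyGroup 𝒢) :
    (partialSumOp 𝒢 N f).coeff = truncate N (bohr 𝒢 f) := rfl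

end Group

end GeneralDirichlet

/-! ### Trapezoidal cosine multipliers -/

namespace GeneralDirichlet

open Set Real

/-! Cut the series off smoothly instead of sharply. Put `a = λ_N`, `b = λ_M`, and let `k` be a de la
Vallée-Poussin type kernel whose cosine transform equals 1 on `[0, a]`, vanishes on `[b, ∞)` and has
modulus at most 1 elsewhere on `[0, ∞)`. Its L¹-norm is `O(log((b + a)/(b - a)) + 1)`
(`exists_trapezoid_kernel`). Averaging a polynomial against `k` over pairs of opposite translates
multiplies its coefficients by this transform and costs at most the L¹-norm of `k`. The result
differs from the N-th partial sum only by the `M - N - 1` terms strictly between N and M, each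
bounded by `‖f‖`.

The kernel can only be applied to polynomials, whereas `f` is merely in `L^∞(G)`. So `f` is first
replaced by Fejér-type means `f * |∑_{γ ∈ A} γ|² / |A|`, where `A` is a finite set of characters.
Since the kernel is nonnegative with integral 1, these means are bounded by `‖f‖`; they are
polynomials whose n-th coefficient is damped by the proportion of `γ ∈ A` with `h_{λ_n} γ ∈ A`. If
`A` is a Følner set for the finitely many characters `h_{λ_n}`, `n < M`, the damping is within `ε`
of 1 there (`exists_fejer_mean`). Letting `ε → 0` gives the bound on the imaginary axis, and
Phragmén–Lindelöf carries it to the half-plane. The resulting constant is absolute: it depends only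
on the kernel construction. -/

theorem integrableOn_one_sub_cos_div_sq (x : ℝ) :
    IntegrableOn (fun t : ℝ => (1 - cos (x * t)) / t ^ 2) (Ioi 0) := by
  have hm : Measurable fun t : ℝ => (1 - cos (x * t)) / t ^ 2 := by fun_prop
  rw [← Ioc_union_Ioi_eq_Ioi (zero_le_one' ℝ)]
  refine IntegrableOn.union ?_ ?_
  · refine Measure.integrableOn_of_bounded (M := x ^ 2 / 2) (by simp)
      hm.aestronglyMeasurable ?_
    filter_upwards [ae_restrict_mem measurableSet_Ioc] with t ht
    have ht0 : 0 < t := ht.1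
    rw [norm_of_nonneg (div_nonneg (by linarith [cos_le_one (x * t)]) (by positivity)),
      div_le_iff₀ (by positivity)]
    have := one_sub_sq_div_two_le_cos (x := x * t)
    nlinarith
  · have h2 : IntegrableOn (fun t : ℝ => 2 * t ^ (-2 : ℝ)) (Ioi 1) :=
      (integrableOn_Ioi_rpow_of_lt (by norm_num) zero_lt_one).const_mul 2
    refine h2.mono' hm.aestronglyMeasurable ?_
    filter_upwards [ae_restrict_mem measurableSet_Ioi] with t ht
    have ht0 : 0 < t := zero_lt_one.trans ht
    rw [norm_of_nonneg (div_nonneg (by linarith [cos_le_one (x * t)]) (by positivity)),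
      rpow_neg ht0.le, rpow_two, div_eq_mul_inv]
    gcongr
    linarith [neg_one_le_cos (x * t)]

/-- The constant `∫₀^∞ (1 - cos t) / t² dt` (equal to `π / 2`). -/
noncomputable def oneSubCosIntegral : ℝ := ∫ t in Ioi (0 : ℝ), (1 - cos t) / t ^ 2

theorem oneSubCosIntegral_pos : 0 < oneSubCosIntegral := by
  unfold oneSubCosIntegral
  have hi := integrableOn_one_sub_cos_div_sq 1
  simp only [one_mul] at hi
  have hnn : ∀ t : ℝ, 0 ≤ (1 - cos t) / t ^ 2 := fun t =>
    div_nonneg (by linarith [cos_le_one t]) (by positivity)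
  rw [setIntegral_pos_iff_support_of_nonneg_ae (Eventually.of_forall hnn) hi]
  have hsub : Ioo (0 : ℝ) 1 ⊆
      (Function.support fun t : ℝ => (1 - cos t) / t ^ 2) ∩ Ioi 0 := by
    intro t ht
    refine ⟨?_, ht.1⟩
    have h1 : cos t < 1 := by
      rw [← cos_zero]
      exact cos_lt_cos_of_nonneg_of_le_pi le_rfl (by linarith [ht.2, pi_gt_three]) ht.1
    exact (div_pos (by linarith) (pow_pos ht.1 2)).ne'
  exact lt_of_lt_of_le (by simp) (measure_mono hsub)

/-- Scaling `t ↦ |x| t` produces the factor `|x|`. Piecewise linear multipliers are then built as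
combinations of such absolute values. -/
theorem integral_one_sub_cos_div_sq (x : ℝ) :
    ∫ t in Ioi (0 : ℝ), (1 - cos (x * t)) / t ^ 2 = |x| * oneSubCosIntegral := by
  rcases eq_or_ne x 0 with rfl | hx
  · simp
  have hx' : 0 < |x| := abs_pos.2 hx
  have h := integral_comp_mul_left_Ioi (fun t : ℝ => (1 - cos t) / t ^ 2) 0 hx'
  rw [mul_zero, smul_eq_mul] at h
  have h2 : ∀ t : ℝ, (1 - cos (x * t)) / t ^ 2 =
      |x| ^ 2 * ((1 - cos (|x| * t)) / (|x| * t) ^ 2) := by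
    intro t
    have hc : cos (|x| * t) = cos (x * t) := by
      rcases abs_choice x with h | h <;> simp [h]
    rw [hc]
    rcases eq_or_ne t 0 with rfl | ht
    · simp
    · field_simp
  simp_rw [h2]
  rw [integral_const_mul, h]
  unfold oneSubCosIntegral
  field_simp

/-- Up to normalization, the kernel whose cosine transform is the trapezoid equal to `1` on
`[-a, a]` and to `0` outside of `[-b, b]`. -/
noncomputable def trapezoidKernel (a b t : ℝ) : ℝ :=
  sin ((b + a) / 2 * t) * sin ((b - a) / 2 * t) / t ^ 2

/-- Product-to-sum formulas; the two plus and two minus signs let the constants 1 cancel, so every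
summand is separately integrable at 0. -/
theorem trapezoidKernel_mul_cos (a b x t : ℝ) :
    trapezoidKernel a b t * cos (x * t) =
      4⁻¹ * ((1 - cos ((b + x) * t)) / t ^ 2 + (1 - cos ((b - x) * t)) / t ^ 2
        - (1 - cos ((a + x) * t)) / t ^ 2 - (1 - cos ((a - x) * t)) / t ^ 2) := by
  have h1 : sin ((b + a) / 2 * t) * sin ((b - a) / 2 * t) = (cos (a * t) - cos (b * t)) / 2 := by
    have ha : a * t = (b + a) / 2 * t - (b - a) / 2 * t := by ring
    have hb : b * t = (b + a) / 2 * t + (b - a) / 2 * t := by ring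
    rw [ha, hb, cos_sub, cos_add]
    ring
  unfold trapezoidKernel
  rw [h1, add_mul, sub_mul, add_mul, sub_mul, cos_add, cos_sub, cos_add, cos_sub]
  ring

theorem integrableOn_trapezoidKernel_mul_cos (a b x : ℝ) :
    IntegrableOn (fun t => trapezoidKernel a b t * cos (x * t)) (Ioi 0) := by
  simp_rw [trapezoidKernel_mul_cos]
  exact ((((integrableOn_one_sub_cos_div_sq _).add (integrableOn_one_sub_cos_div_sq _)).sub
    (integrableOn_one_sub_cos_div_sq _)).sub (integrableOn_one_sub_cos_div_sq _)).const_mul _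

theorem integrableOn_trapezoidKernel (a b : ℝ) :
    IntegrableOn (trapezoidKernel a b) (Ioi 0) := by
  simpa using integrableOn_trapezoidKernel_mul_cos a b 0

theorem integral_trapezoidKernel_mul_cos (a b x : ℝ) :
    ∫ t in Ioi (0 : ℝ), trapezoidKernel a b t * cos (x * t) =
      oneSubCosIntegral / 4 * (|b + x| + |b - x| - |a + x| - |a - x|) := by
  simp_rw [trapezoidKernel_mul_cos]
  have hI := integrableOn_one_sub_cos_div_sq
  have h1 : IntegrableOn (fun t : ℝ => (1 - cos ((b + x) * t)) / t ^ 2 +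
      (1 - cos ((b - x) * t)) / t ^ 2) (Ioi 0) := (hI _).add (hI _)
  have h2 : IntegrableOn (fun t : ℝ => (1 - cos ((b + x) * t)) / t ^ 2 +
      (1 - cos ((b - x) * t)) / t ^ 2 - (1 - cos ((a + x) * t)) / t ^ 2) (Ioi 0) := h1.sub (hI _)
  rw [integral_const_mul, integral_sub h2 (hI _), integral_sub h1 (hI _),
    integral_add (hI _) (hI _)]
  simp only [integral_one_sub_cos_div_sq]
  ring

/-- With `c = (b + a)/2` and `h = (b - a)/2`, split at `1/c ≤ 1/h`. Using `|sin y| ≤ |y|` for both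
sines, then only for the slower one, then for neither, bounds the integrand by `c h`, `h / t` and `1
/ t²`; the pieces contribute `h`, `h log (c / h)` and `h`. -/
theorem integral_abs_trapezoidKernel_le {a b : ℝ} (ha : 0 ≤ a) (hab : a < b) :
    ∫ t in Ioi (0 : ℝ), |trapezoidKernel a b t| ≤
      (b - a) / 2 * (2 + log ((b + a) / (b - a))) := by
  have hlog : log ((b + a) / (b - a)) = log (((b - a) / 2)⁻¹ / ((b + a) / 2)⁻¹) := by
    congr 1
    have : b - a ≠ 0 := by linarith
    have : b + a ≠ 0 := by linarith
    field_simp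
  rw [hlog]
  have hint : IntegrableOn (fun t => |trapezoidKernel a b t|) (Ioi 0) :=
    (integrableOn_trapezoidKernel a b).abs
  unfold trapezoidKernel at *
  have hh : 0 < (b - a) / 2 := by linarith
  have hhc : (b - a) / 2 ≤ (b + a) / 2 := by linarith
  generalize (b - a) / 2 = h at *
  generalize (b + a) / 2 = c at *
  have hc : 0 < c := hh.trans_le hhc
  have hle : c⁻¹ ≤ h⁻¹ := inv_anti₀ hh hhc
  have hc' : 0 < c⁻¹ := inv_pos.2 hc
  have hh' : 0 < h⁻¹ := inv_pos.2 hh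
  have hsin : ∀ x : ℝ, ∀ t : ℝ, 0 < t → 0 < x → |sin (x * t)| ≤ x * t := fun x t ht hx =>
    abs_sin_le_abs.trans_eq (abs_of_pos (mul_pos hx ht))
  rw [← Ioc_union_Ioi_eq_Ioi hc'.le] at hint ⊢
  rw [← Ioc_union_Ioi_eq_Ioi hle] at hint ⊢
  have hi1 := hint.left_of_union
  have hi2 := hint.right_of_union.left_of_union
  have hi3 := hint.right_of_union.right_of_union
  have hd : Disjoint (Ioc c⁻¹ h⁻¹) (Ioi h⁻¹) := Ioc_disjoint_Ioi le_rfl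
  have hd' : Disjoint (Ioc 0 c⁻¹) (Ioc c⁻¹ h⁻¹ ∪ Ioi h⁻¹) := by
    rw [Ioc_union_Ioi_eq_Ioi hle]
    exact Ioc_disjoint_Ioi le_rfl
  rw [setIntegral_union hd' (measurableSet_Ioc.union measurableSet_Ioi) hi1 hint.right_of_union,
    setIntegral_union hd measurableSet_Ioi hi2 hi3]
  have e1 : ∫ t in Ioc 0 c⁻¹, |sin (c * t) * sin (h * t) / t ^ 2| ≤ h := by
    calc _ ≤ ∫ t in Ioc 0 c⁻¹, c * h := by
          refine setIntegral_mono_on hi1 (integrableOn_const (by simp)) measurableSet_Ioc fun t ht => ?_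
          have ht0 : 0 < t := ht.1
          rw [abs_div, abs_mul, abs_of_pos (pow_pos ht0 2), div_le_iff₀ (pow_pos ht0 2)]
          calc _ ≤ (c * t) * (h * t) := by gcongr <;> exact hsin _ _ ht0 ‹_›
            _ = _ := by ring
      _ = h := by
          simp only [integral_const, smul_eq_mul]
          simp [hc'.le, hc.ne']
  have e2 : ∫ t in Ioc c⁻¹ h⁻¹, |sin (c * t) * sin (h * t) / t ^ 2| ≤ h * log (h⁻¹ / c⁻¹) := by
    have hcont : ContinuousOn (fun t : ℝ => h * t⁻¹) (Icc c⁻¹ h⁻¹) :=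
      continuousOn_const.mul (continuousOn_inv₀.mono fun t ht => (hc'.trans_le ht.1).ne')
    calc _ ≤ ∫ t in Ioc c⁻¹ h⁻¹, h * t⁻¹ := by
          refine setIntegral_mono_on hi2
            (hcont.integrableOn_Icc.mono_set Ioc_subset_Icc_self) measurableSet_Ioc fun t ht => ?_
          have ht0 : 0 < t := hc'.trans ht.1
          rw [abs_div, abs_mul, abs_of_pos (pow_pos ht0 2), div_le_iff₀ (pow_pos ht0 2)]
          calc _ ≤ 1 * (h * t) := by
                gcongr
                · exact abs_sin_le_one _
                · exact hsin _ _ ht0 hh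
            _ = _ := by field_simp
      _ = h * log (h⁻¹ / c⁻¹) := by
          rw [← intervalIntegral.integral_of_le hle, intervalIntegral.integral_const_mul,
            integral_inv_of_pos hc' hh']
  have e3 : ∫ t in Ioi h⁻¹, |sin (c * t) * sin (h * t) / t ^ 2| ≤ h := by
    calc _ ≤ ∫ t in Ioi h⁻¹, t ^ (-2 : ℝ) := by
          refine setIntegral_mono_on hi3 (integrableOn_Ioi_rpow_of_lt (by norm_num) hh')
            measurableSet_Ioi fun t ht => ?_
          have ht0 : 0 < t := hh'.trans ht
          rw [abs_div, abs_mul, abs_of_pos (pow_pos ht0 2), rpow_neg ht0.le, rpow_two,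
            ← one_div]
          gcongr
          exact mul_le_one₀ (abs_sin_le_one _) (abs_nonneg _) (abs_sin_le_one _)
      _ = h := by
          rw [integral_Ioi_rpow_of_lt (by norm_num) hh']
          norm_num
          rw [rpow_neg_one, inv_inv]
  linarith

/-- Kernels of de la Vallée-Poussin type. -/
theorem exists_trapezoid_kernel :
    ∃ C : ℝ, 1 ≤ C ∧ ∀ a b : ℝ, 0 ≤ a → a < b → ∃ k : ℝ → ℝ, IntegrableOn k (Ioi 0) ∧
      ∫ t in Ioi (0 : ℝ), |k t| ≤ C * (log ((b + a) / (b - a)) + 1) ∧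
      (∀ x, 0 ≤ x → x ≤ a → ∫ t in Ioi (0 : ℝ), k t * cos (x * t) = 1) ∧
      (∀ x, b ≤ x → ∫ t in Ioi (0 : ℝ), k t * cos (x * t) = 0) ∧
      ∀ x, 0 ≤ x → |∫ t in Ioi (0 : ℝ), k t * cos (x * t)| ≤ 1 := by
  have hJ := oneSubCosIntegral_pos
  -- The summand 1 forces `C ≥ 1`, which lets the same constant absorb the `M - N - 1` middle terms
  -- in the theorem.
  refine ⟨2 / oneSubCosIntegral + 1, by linarith [div_pos two_pos hJ], fun a b ha hab => ?_⟩
  have hba : 0 < b - a := sub_pos.2 hab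
  have htr : ∀ x, ∫ t in Ioi (0 : ℝ),
      (2 / (oneSubCosIntegral * (b - a))) * trapezoidKernel a b t * cos (x * t) =
      (|b + x| + |b - x| - |a + x| - |a - x|) / (2 * (b - a)) := fun x => by
    simp_rw [mul_assoc]
    rw [integral_const_mul, integral_trapezoidKernel_mul_cos]
    field_simp
    norm_num
  refine ⟨fun t => 2 / (oneSubCosIntegral * (b - a)) * trapezoidKernel a b t,
    (integrableOn_trapezoidKernel a b).const_mul _, ?_, fun x hx hxa => ?_, fun x hbx => ?_,
    fun x hx => ?_⟩
  · simp_rw [abs_mul]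
    rw [integral_const_mul, abs_of_pos (by positivity)]
    have hl : 0 ≤ log ((b + a) / (b - a)) :=
      log_nonneg ((one_le_div hba).2 (by linarith))
    calc _ ≤ 2 / (oneSubCosIntegral * (b - a)) *
          ((b - a) / 2 * (2 + log ((b + a) / (b - a)))) := by
          gcongr
          exact integral_abs_trapezoidKernel_le ha hab
      _ = 1 / oneSubCosIntegral * (2 + log ((b + a) / (b - a))) := by field_simp
      _ ≤ 1 / oneSubCosIntegral * (2 * (log ((b + a) / (b - a)) + 1)) := by
          gcongr
          linarith
      _ = 2 / oneSubCosIntegral * (log ((b + a) / (b - a)) + 1) := by ring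
      _ ≤ _ := by
          gcongr
          linarith
  · rw [htr, abs_of_nonneg (by linarith : 0 ≤ b + x), abs_of_nonneg (by linarith : 0 ≤ b - x),
      abs_of_nonneg (by linarith : 0 ≤ a + x), abs_of_nonneg (by linarith : 0 ≤ a - x)]
    field_simp
    ring
  · rw [htr, abs_of_nonneg (by linarith : 0 ≤ b + x), abs_of_nonpos (by linarith : b - x ≤ 0),
      abs_of_nonneg (by linarith : 0 ≤ a + x), abs_of_nonpos (by linarith : a - x ≤ 0)]
    ring
  · rw [htr, abs_le, le_div_iff₀ (by positivity), div_le_iff₀ (by positivity)]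
    constructor <;> cases abs_cases (b + x) <;> cases abs_cases (b - x) <;>
      cases abs_cases (a + x) <;> cases abs_cases (a - x) <;> linarith

/-- Cosine multipliers act boundedly on trigonometric polynomials. -/
theorem norm_sum_mul_cosTransform_le {ι : Type*} (s : Finset ι) (b : ι → ℂ) (x : ι → ℝ)
    {k : ℝ → ℝ} (hk : IntegrableOn k (Ioi 0)) {B : ℝ}
    (hB : ∀ t : ℝ, ‖∑ i ∈ s, b i * Complex.exp (-Complex.I * x i * t)‖ ≤ B) (t : ℝ) :
    ‖∑ i ∈ s, ((∫ u in Ioi (0 : ℝ), k u * cos (x i * u) : ℝ) : ℂ) *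
      (b i * Complex.exp (-Complex.I * x i * t))‖ ≤ (∫ u in Ioi (0 : ℝ), |k u|) * B := by
  set q : ℝ → ℂ := fun t => ∑ i ∈ s, b i * Complex.exp (-Complex.I * x i * t) with hq
  have hcos : ∀ y : ℝ, IntegrableOn (fun u => k u * cos (y * u)) (Ioi 0) := fun y => by
    refine hk.mul_bdd (c := 1) (by fun_prop) ?_
    exact Eventually.of_forall fun u => by simpa using abs_cos_le_one (y * u)
  -- The factor `cos (x_i u)` comes from averaging the translates of `q` by `u` and `-u`.
  have hpt : ∀ u : ℝ, ∑ i ∈ s, ((k u * cos (x i * u) : ℝ) : ℂ) *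
      (b i * Complex.exp (-Complex.I * x i * t)) = k u * ((q (t + u) + q (t - u)) / 2) := by
    intro u
    simp only [hq]
    rw [← Finset.sum_add_distrib, Finset.sum_div, Finset.mul_sum]
    refine Finset.sum_congr rfl fun i _ => ?_
    push_cast
    rw [Complex.cos, mul_add (-Complex.I * (x i : ℂ)), mul_sub (-Complex.I * (x i : ℂ)),
      Complex.exp_add, Complex.exp_sub,
      show (x i : ℂ) * u * Complex.I = -(-Complex.I * x i * u) by ring,
      show -((x i : ℂ) * u) * Complex.I = -Complex.I * x i * u by ring, Complex.exp_neg]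
    ring
  have hint : ∑ i ∈ s, ((∫ u in Ioi (0 : ℝ), k u * cos (x i * u) : ℝ) : ℂ) *
      (b i * Complex.exp (-Complex.I * x i * t)) =
      ∫ u in Ioi (0 : ℝ), k u * ((q (t + u) + q (t - u)) / 2) := by
    simp_rw [← hpt]
    rw [integral_finsetSum]
    · refine Finset.sum_congr rfl fun i _ => ?_
      rw [integral_mul_const, integral_complex_ofReal]
    · intro i _
      exact (hcos (x i)).ofReal.mul_const _
  rw [hint, ← integral_mul_const]
  refine norm_integral_le_of_norm_le (hk.abs.mul_const B) (Eventually.of_forall fun u => ?_)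
  rw [norm_mul, Complex.norm_real, norm_eq_abs]
  gcongr
  rw [norm_div, Complex.norm_two, div_le_iff₀ two_pos]
  linarith [norm_add_le (q (t + u)) (q (t - u)), hB (t + u), hB (t - u)]

end GeneralDirichlet

/-! ### Følner sets in commutative groups -/

namespace GeneralDirichlet

open scoped Pointwise

/-- Finitely generated commutative groups have polynomial growth. -/
theorem card_finset_pow_le {Γ : Type*} [CommGroup Γ] [DecidableEq Γ] (S : Finset Γ) (L : ℕ) :
    (S ^ L).card ≤ (L + 1) ^ S.card := by
  classical
  -- By commutativity a product of `L` elements of `S` depends only on how often each occurs.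
  have hsub : S ^ L ⊆ (Fintype.piFinset fun _ : S => Finset.range (L + 1)).image
      fun e : S → ℕ => ∏ s : S, (s : Γ) ^ e s := by
    induction L with
    | zero =>
      intro g hg
      rw [pow_zero, Finset.mem_one] at hg
      refine Finset.mem_image.2 ⟨fun _ => 0, by simp, by simp [hg]⟩
    | succ L ih =>
      intro g hg
      rw [pow_succ] at hg
      obtain ⟨g', hg', s, hs, rfl⟩ := Finset.mem_mul.1 hg
      obtain ⟨e, he, rfl⟩ := Finset.mem_image.1 (ih hg')
      refine Finset.mem_image.2 ⟨e + Pi.single ⟨s, hs⟩ 1, ?_, ?_⟩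
      · rw [Fintype.mem_piFinset] at he ⊢
        intro i
        have := Finset.mem_range.1 (he i)
        rw [Finset.mem_range, Pi.add_apply, Pi.single_apply]
        split_ifs <;> omega
      · simp only [Pi.add_apply, pow_add, Finset.prod_mul_distrib]
        congr 1
        rw [Finset.prod_eq_single ⟨s, hs⟩] <;> simp +contextual
  refine (Finset.card_le_card hsub).trans (Finset.card_image_le.trans ?_)
  simp

/-- Følner sets in a discrete commutative group. -/
theorem exists_folner_finset {Γ : Type*} [CommGroup Γ] [DecidableEq Γ] (S : Finset Γ) {ε : ℝ}
    (hε : 0 < ε) :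
    ∃ A : Finset Γ, A.Nonempty ∧
      ∀ s ∈ S, (1 - ε) * A.card ≤ (A.filter fun γ => s * γ ∈ A).card := by
  -- Adding 1 makes the powers `T ^ L` increase with `L`.
  set T : Finset Γ := insert 1 S with hT
  have h1 : (1 : Γ) ∈ T := Finset.mem_insert_self _ _
  have hne : ∀ L : ℕ, (T ^ L).Nonempty := fun L => Finset.Nonempty.pow ⟨1, h1⟩
  -- Otherwise the powers would grow exponentially, against polynomial growth.
  obtain ⟨L, hL⟩ : ∃ L : ℕ, ((T ^ (L + 1)).card : ℝ) ≤ (1 + ε) * (T ^ L).card := by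
    by_contra! hcon
    have hgrow : ∀ L : ℕ, (1 + ε) ^ L ≤ ((T ^ L).card : ℝ) := by
      intro L
      induction L with
      | zero => simp
      | succ L ih =>
        calc (1 + ε) ^ (L + 1) = (1 + ε) * (1 + ε) ^ L := pow_succ' _ _
          _ ≤ (1 + ε) * (T ^ L).card := by gcongr
          _ ≤ _ := (hcon L).le
    have hlim := (tendsto_pow_const_div_const_pow_of_one_lt T.card
      (show (1 : ℝ) < 1 + ε by linarith)).comp (tendsto_add_atTop_nat 1)
    have hε' : 0 < (1 + ε)⁻¹ := by positivity
    obtain ⟨L, hL⟩ := (hlim.eventually (gt_mem_nhds hε')).exists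
    have h2 : (((T ^ L).card : ℕ) : ℝ) ≤ ((L + 1 : ℕ) : ℝ) ^ T.card := by
      exact_mod_cast card_finset_pow_le T L
    have h3 := (hgrow L).trans h2
    simp only [Function.comp_apply] at hL
    rw [div_lt_iff₀ (by positivity), pow_succ', inv_mul_cancel_left₀ (by positivity)] at hL
    linarith
  refine ⟨T ^ L, hne L, fun s hs => ?_⟩
  have hsT : s ∈ T := Finset.mem_insert_of_mem hs
  set A := T ^ L
  have hA : A ⊆ T ^ (L + 1) := Finset.pow_subset_pow_right h1 (Nat.le_succ L)
  -- Elements that `s` moves out of `A` land in `T ^ (L + 1) \ A`, which has at most `ε |A|`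
  -- elements by the choice of `L`.
  have hsub : (A.filter fun γ => s * γ ∉ A).image (s * ·) ⊆ T ^ (L + 1) \ A := by
    intro g hg
    obtain ⟨γ, hγ, rfl⟩ := Finset.mem_image.1 hg
    rw [Finset.mem_filter] at hγ
    refine Finset.mem_sdiff.2 ⟨?_, hγ.2⟩
    rw [pow_succ']
    exact Finset.mul_mem_mul hsT hγ.1
  have hcard := Finset.card_le_card hsub
  rw [Finset.card_image_of_injective _ (mul_right_injective s), Finset.card_sdiff_of_subset hA] at hcard
  have hsum := Finset.card_filter_add_card_filter_not (s := A) (fun γ => s * γ ∈ A)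
  have hle := Finset.card_le_card hA
  have : (2 * A.card : ℝ) ≤ (A.filter fun γ => s * γ ∈ A).card + (T ^ (L + 1)).card := by
    exact_mod_cast (by omega : 2 * A.card ≤ (A.filter fun γ => s * γ ∈ A).card +
      (T ^ (L + 1)).card)
  linarith

end GeneralDirichlet

/-! ### Fejér-type means on the group -/

namespace GeneralDirichlet

section

variable {G : Type u} [CommGroup G] [TopologicalSpace G]

theorem coe_div_character_apply (γ γ' : PontryaginDual G) (x : G) :
    (((γ / γ') x : Circle) : ℂ) = γ x * (starRingEnd ℂ) (γ' x : ℂ) := by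
  have h : (γ / γ') x = γ x / γ' x := rfl
  rw [h, Circle.coe_div, div_eq_mul_inv, ← Circle.coe_inv, Circle.coe_inv_eq_conj]

theorem continuous_coe_character (χ : PontryaginDual G) : Continuous fun x : G => (χ x : ℂ) :=
  continuous_subtype_val.comp (map_continuous χ)

/-- The derivative at 0 of `t ↦ e^{-i λ_n t}` recovers `λ_n`. Injectivity makes the set of indices n
whose character lies in a given finite set finite. -/
theorem DirichletGroup.h_injective {lam : Frequency} (𝒢 : DirichletGroup lam G) :
    Function.Injective 𝒢.h := by
  intro m n hmn
  have hexp : ∀ t : ℝ, Complex.exp (-Complex.I * (lam m : ℂ) * (t : ℂ)) =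
      Complex.exp (-Complex.I * (lam n : ℂ) * (t : ℂ)) := fun t => by
    rw [← 𝒢.h_apply_β, ← 𝒢.h_apply_β, hmn]
  have hd : ∀ y : ℝ, HasDerivAt
      (fun t : ℝ => Complex.exp (-Complex.I * (y : ℂ) * (t : ℂ))) (-Complex.I * (y : ℂ)) 0 := by
    intro y
    have h := ((hasDerivAt_id (0 : ℝ)).ofReal_comp.const_mul (-Complex.I * (y : ℂ))).cexp
    simpa using h
  have h1 := (hd (lam m)).unique ((funext hexp : _ = _) ▸ hd (lam n))
  have h2 : ((lam m : ℝ) : ℂ) = (lam n : ℝ) :=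
    mul_left_cancel₀ (neg_ne_zero.2 Complex.I_ne_zero) h1
  exact lam.strictMono.injective (Complex.ofReal_injective h2)

variable [IsTopologicalGroup G] [CompactSpace G] [MeasurableSpace G] [BorelSpace G]

instance : IsProbabilityMeasure (haarProb G) :=
  ⟨by simpa using Measure.haarMeasure_self (K₀ := (⊤ : TopologicalSpace.PositiveCompacts G))⟩

/-- Translating by `g` with `χ g ≠ 1` multiplies the integral by `χ g` without changing it. -/
theorem integral_character_eq_zero {χ : PontryaginDual G} (hχ : χ ≠ 1) :
    ∫ x, (χ x : ℂ) ∂(haarProb G) = 0 := by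
  obtain ⟨g, hg⟩ : ∃ g, χ g ≠ 1 := by
    by_contra! h
    exact hχ (PontryaginDual.ext h)
  have h := integral_mul_left_eq_self (μ := haarProb G) (fun x => (χ x : ℂ)) g
  simp only [map_mul, Circle.coe_mul] at h
  rw [integral_const_mul] at h
  have hg' : (χ g : ℂ) - 1 ≠ 0 := sub_ne_zero.2 fun h' => hg (Circle.ext (by simpa using h'))
  refine (mul_eq_zero.1 ?_).resolve_left hg'
  linear_combination h

theorem integral_conj_character [DecidableEq (PontryaginDual G)] (χ : PontryaginDual G) :
    ∫ x, (starRingEnd ℂ) (χ x : ℂ) ∂(haarProb G) = if χ = 1 then 1 else 0 := by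
  rw [integral_conj]
  split_ifs with h
  · simp [h]
  · simp [integral_character_eq_zero h]

theorem ae_norm_le_norm (f : Lp ℂ ⊤ (haarProb G)) : ∀ᵐ x ∂(haarProb G), ‖f x‖ ≤ ‖f‖ := by
  filter_upwards [ae_le_eLpNormEssSup (f := (f : G → ℂ)) (μ := haarProb G)] with x hx
  rw [Lp.norm_def, eLpNorm_exponent_top]
  have := ENNReal.toReal_mono
    (by simpa [eLpNorm_exponent_top] using Lp.eLpNorm_ne_top f) hx
  simpa using this

/-- The convolution of `f` with the Fejér-type kernel `|∑_{γ ∈ A} γ|²` is bounded. -/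
theorem norm_sum_fourierCoeffGroup_div_le (f : Lp ℂ ⊤ (haarProb G))
    (A : Finset (PontryaginDual G)) (y : G) :
    ‖∑ γ ∈ A, ∑ γ' ∈ A, fourierCoeffGroup f (γ / γ') * ((γ / γ') y : ℂ)‖ ≤ A.card * ‖f‖ := by
  classical
  set S : G → ℂ := fun x => ∑ γ ∈ A, (γ y : ℂ) * (starRingEnd ℂ) (γ x : ℂ) with hS
  have hsq : ∀ x, ((‖S x‖ ^ 2 : ℝ) : ℂ) =
      ∑ γ ∈ A, ∑ γ' ∈ A, (starRingEnd ℂ) ((γ / γ') x : ℂ) * ((γ / γ') y : ℂ) := by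
    intro x
    rw [Complex.ofReal_pow, ← Complex.mul_conj', hS]
    simp only [map_sum, Finset.sum_mul_sum, map_mul, Complex.conj_conj, coe_div_character_apply]
    exact Finset.sum_congr rfl fun γ _ => Finset.sum_congr rfl fun γ' _ => by ring
  have hconj : ∀ χ : PontryaginDual G,
      Integrable (fun x => (starRingEnd ℂ) (χ x : ℂ)) (haarProb G) := fun χ =>
    (Complex.continuous_conj.comp (continuous_coe_character χ)).integrable_of_hasCompactSupport
      (HasCompactSupport.of_compactSpace _)
  -- By orthogonality only the diagonal `γ = γ'` survives.
  have hSint : ∫ x, ‖S x‖ ^ 2 ∂(haarProb G) = A.card := by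
    apply Complex.ofReal_injective
    rw [← integral_complex_ofReal]
    simp_rw [hsq]
    rw [integral_finsetSum _ fun γ _ => integrable_finsetSum _ fun γ' _ =>
      (hconj _).mul_const _]
    simp_rw [integral_finsetSum A fun γ' _ => (hconj (_ / γ')).mul_const _, integral_mul_const,
      integral_conj_character, div_eq_one]
    simp +contextual [Finset.sum_ite_eq, ite_mul]
  have hint : ∑ γ ∈ A, ∑ γ' ∈ A, fourierCoeffGroup f (γ / γ') * ((γ / γ') y : ℂ) =
      ∫ x, f x * ((‖S x‖ ^ 2 : ℝ) : ℂ) ∂(haarProb G) := by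
    simp_rw [hsq, Finset.mul_sum, ← mul_assoc]
    rw [integral_finsetSum _ fun γ _ => integrable_finsetSum _ fun γ' _ =>
      (integrable_mul_character f _).mul_const _]
    simp_rw [integral_finsetSum A fun γ' _ =>
      (integrable_mul_character f (_ / γ')).mul_const _, integral_mul_const]
    rfl
  have hScont : Continuous fun x => ‖S x‖ ^ 2 := by
    refine (continuous_norm.comp ?_).pow 2
    exact continuous_finsetSum _ fun γ _ =>
      continuous_const.mul (Complex.continuous_conj.comp (continuous_coe_character γ))
  rw [hint, mul_comm, ← hSint, ← integral_const_mul]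
  refine norm_integral_le_of_norm_le
    ((hScont.integrable_of_hasCompactSupport (HasCompactSupport.of_compactSpace _)).const_mul _) ?_
  filter_upwards [ae_norm_le_norm f] with x hx
  rw [norm_mul, Complex.norm_real, Real.norm_of_nonneg (by positivity)]
  gcongr

/-- Fejér-type means of the Dirichlet series of `f ∈ H_∞^λ(G)`: Dirichlet polynomials bounded by
`‖f‖` on the imaginary axis, with finitely many prescribed coefficients close to those of `f`. -/
theorem exists_fejer_mean {lam : Frequency} (𝒢 : DirichletGroup lam G) (f : HInftyGroup 𝒢)
    (K : Finset ℕ+) {ε : ℝ} (hε : 0 < ε) :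
    ∃ (F : Finset ℕ+) (w : ℕ+ → ℝ), K ⊆ F ∧ (∀ n, 0 ≤ w n ∧ w n ≤ 1) ∧
      (∀ n ∈ K, 1 - ε ≤ w n) ∧
      ∀ t : ℝ, ‖∑ n ∈ F, (w n * bohr 𝒢 f n : ℂ) *
        Complex.exp (-Complex.I * (lam n : ℂ) * (t : ℂ))‖ ≤ ‖f‖ := by
  classical
  obtain ⟨A, hA, hAK⟩ := exists_folner_finset (K.image 𝒢.h) hε
  have hA0 : (0 : ℝ) < A.card := by exact_mod_cast hA.card_pos
  set F : Finset ℕ+ :=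
    K ∪ ((A ×ˢ A).image fun p => p.1 / p.2).preimage 𝒢.h 𝒢.h_injective.injOn with hF
  refine ⟨F, fun n => (A.filter fun γ => 𝒢.h n * γ ∈ A).card / A.card,
    Finset.subset_union_left, fun n => ⟨by positivity, ?_⟩, fun n hn => ?_, fun t => ?_⟩
  · rw [div_le_one hA0]
    exact_mod_cast Finset.card_filter_le _ _
  · rw [le_div_iff₀ hA0]
    exact hAK _ (Finset.mem_image_of_mem _ hn)
  set y : G := 𝒢.β (Multiplicative.ofAdd t)
  set φ : PontryaginDual G → ℂ :=
    fun χ => fourierCoeffGroup (f : Lp ℂ ⊤ (haarProb G)) χ * (χ y : ℂ) with hφ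
  -- A quotient `γ / γ'` is either `h_{λ_n}` for exactly one n, or outside the allowed spectrum,
  -- where the coefficient of `f` vanishes.
  have hsplit : ∀ γ ∈ A, ∀ γ' ∈ A,
      φ (γ / γ') = ∑ n ∈ F, if 𝒢.h n * γ' = γ then φ (𝒢.h n) else 0 := by
    intro γ hγ γ' hγ'
    by_cases hex : ∃ n, γ / γ' = 𝒢.h n
    · obtain ⟨n, hn⟩ := hex
      have hnF : n ∈ F := by
        refine Finset.mem_union_right _ (Finset.mem_preimage.2 ?_)
        exact Finset.mem_image.2 ⟨(γ, γ'), Finset.mk_mem_product hγ hγ', hn⟩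
      rw [Finset.sum_eq_single n, if_pos (by rw [← hn, div_mul_cancel]), hn]
      · intro m _ hmn
        refine if_neg fun hm => hmn (𝒢.h_injective ?_)
        rw [← hn, ← hm, mul_div_cancel_right]
      · exact fun h => absurd hnF h
    · push Not at hex
      have h0 : φ (γ / γ') = 0 := by
        rw [hφ]
        simp only
        rw [f.2 _ hex, zero_mul]
      rw [h0]
      refine (Finset.sum_eq_zero fun n _ => if_neg fun hn => hex n ?_).symm
      rw [← hn, mul_div_cancel_right]
  -- Grouping pairs by their quotient, `h_{λ_n}` occurs once for each `γ' ∈ A` with `h_{λ_n} γ' ∈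
  -- A`; this is the weight times `|A|`.
  have hsum : ∑ γ ∈ A, ∑ γ' ∈ A, φ (γ / γ') =
      A.card * ∑ n ∈ F, ((((A.filter fun γ => 𝒢.h n * γ ∈ A).card / A.card : ℝ) : ℂ) *
        bohr 𝒢 f n) * Complex.exp (-Complex.I * (lam n : ℂ) * (t : ℂ)) := by
    rw [Finset.sum_congr rfl fun γ hγ => Finset.sum_congr rfl fun γ' hγ' => hsplit γ hγ γ' hγ',
      Finset.sum_comm]
    simp_rw [Finset.sum_comm (s := A) (t := F)]
    rw [Finset.mul_sum]
    refine Finset.sum_congr rfl fun n _ => ?_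
    have hin : ∀ γ' ∈ A, (∑ γ ∈ A, if 𝒢.h n * γ' = γ then φ (𝒢.h n) else 0) =
        if 𝒢.h n * γ' ∈ A then φ (𝒢.h n) else 0 := fun γ' _ => Finset.sum_ite_eq _ _ _
    rw [Finset.sum_congr rfl hin, ← Finset.sum_filter, Finset.sum_const, nsmul_eq_mul,
      ← 𝒢.h_apply_β]
    have hA0' : (A.card : ℂ) ≠ 0 := by exact_mod_cast hA0.ne'
    push_cast
    change _ * (fourierCoeffGroup (f : Lp ℂ ⊤ (haarProb G)) (𝒢.h n) * _) =
      _ * (_ * fourierCoeffGroup (f : Lp ℂ ⊤ (haarProb G)) (𝒢.h n) * _)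
    field_simp
    rfl
  have hle := norm_sum_fourierCoeffGroup_div_le (f : Lp ℂ ⊤ (haarProb G)) A y
  change ‖∑ γ ∈ A, ∑ γ' ∈ A, φ (γ / γ')‖ ≤ _ at hle
  rw [hsum, norm_mul, Complex.norm_natCast] at hle
  exact le_of_mul_le_mul_left hle hA0

end

end GeneralDirichlet

/-! ### Partial sums on the imaginary axis and on the half-plane -/

namespace GeneralDirichlet

/-- Dirichlet polynomials attain their supremum over the right half-plane on its boundary. -/
theorem norm_evalPartial_le_of_imaginary_axis (lam : Frequency) (a : ℕ+ → ℂ) (N : ℕ+) {B : ℝ}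
    (hB : ∀ t : ℝ, ‖∑ n ∈ Finset.Icc 1 N,
      a n * Complex.exp (-Complex.I * (lam n : ℂ) * (t : ℂ))‖ ≤ B)
    {s : ℂ} (hs : s ∈ rightHalfPlane) : ‖evalPartial lam a N s‖ ≤ B := by
  have hd : Differentiable ℂ (evalPartial lam a N) := by
    unfold evalPartial
    fun_prop
  refine PhragmenLindelof.right_half_plane_of_bounded_on_real hd.diffContOnCl
    -- Growth coefficient 0: the polynomial is already bounded on the half-plane by the sum of the
    -- moduli of its coefficients.
    ⟨1, one_lt_two, 0, ?_⟩ ?_ (fun t => ?_) (le_of_lt hs)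
  · refine Asymptotics.IsBigO.of_bound (∑ n ∈ Finset.Icc 1 N, ‖a n‖) ?_
    refine Eventually.filter_mono inf_le_right (eventually_principal.2 fun z hz => ?_)
    simpa using norm_evalPartial_le lam a N hz
  · refine isBoundedUnder_of_eventually_le (a := ∑ n ∈ Finset.Icc 1 N, ‖a n‖) ?_
    filter_upwards [eventually_gt_atTop 0] with x hx
    exact norm_evalPartial_le lam a N (by simpa [rightHalfPlane] using hx)
  · refine le_of_eq_of_le ?_ (hB t)
    unfold evalPartial
    congr 1
    refine Finset.sum_congr rfl fun n _ => ?_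
    congr 2
    ring

variable {lam : Frequency} {G : Type u} [CommGroup G] [TopologicalSpace G]
  [IsTopologicalGroup G] [CompactSpace G] [MeasurableSpace G] [BorelSpace G]

theorem norm_bohr_le (𝒢 : DirichletGroup lam G) (f : HInftyGroup 𝒢) (n : ℕ+) :
    ‖bohr 𝒢 f n‖ ≤ ‖f‖ :=
  norm_fourierCoeffGroup_le (f : Lp ℂ ⊤ (haarProb G)) (𝒢.h n)

theorem norm_exp_frequency (y t : ℝ) : ‖Complex.exp (-Complex.I * (y : ℂ) * (t : ℂ))‖ = 1 := by
  rw [Complex.norm_exp]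
  simp

theorem card_Ioo_pnat {N M : ℕ+} (hNM : N < M) :
    ((Finset.Ioo N M).card : ℝ) = (M : ℝ) - (N : ℝ) - 1 := by
  have h : (N : ℕ) < M := hNM
  rw [PNat.card_Ioo, Nat.sub_sub, Nat.cast_sub h]
  push_cast
  ring

/-- The bound for the partial sums on the imaginary axis by the `L¹`-norm of a kernel. -/
theorem norm_partialSum_le_of_kernel (𝒢 : DirichletGroup lam G) (f : HInftyGroup 𝒢) {N M : ℕ+}
    (hNM : N < M) {k : ℝ → ℝ} (hk : IntegrableOn k (Set.Ioi 0))
    (h1 : ∀ x, 0 ≤ x → x ≤ lam N → ∫ t in Set.Ioi (0 : ℝ), k t * Real.cos (x * t) = 1)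
    (h0 : ∀ x, lam M ≤ x → ∫ t in Set.Ioi (0 : ℝ), k t * Real.cos (x * t) = 0)
    (hle : ∀ x, 0 ≤ x → |∫ t in Set.Ioi (0 : ℝ), k t * Real.cos (x * t)| ≤ 1) (t : ℝ) :
    ‖∑ n ∈ Finset.Icc 1 N, bohr 𝒢 f n * Complex.exp (-Complex.I * (lam n : ℂ) * (t : ℂ))‖ ≤
      ((∫ u in Set.Ioi (0 : ℝ), |k u|) + ((M : ℝ) - (N : ℝ) - 1)) * ‖f‖ := by
  have key : ∀ ε : ℝ, 0 < ε →
      ‖∑ n ∈ Finset.Icc 1 N, bohr 𝒢 f n * Complex.exp (-Complex.I * (lam n : ℂ) * (t : ℂ))‖ ≤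
      ((∫ u in Set.Ioi (0 : ℝ), |k u|) + ((M : ℝ) - (N : ℝ) - 1)) * ‖f‖ + ε * (N * ‖f‖) := by
    intro ε hε
    -- `F` must contain all indices below M, so that the terms of `F` outside this range are killed
    -- by the multiplier.
    obtain ⟨F, w, hKF, hw, hwK, hF⟩ := exists_fejer_mean 𝒢 f (Finset.Iio M) hε
    have hmult := norm_sum_mul_cosTransform_le F (fun n => (w n * bohr 𝒢 f n : ℂ)) lam.val hk hF t
    set m : ℝ → ℝ := fun x => ∫ u in Set.Ioi (0 : ℝ), k u * Real.cos (x * u) with hm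
    set e : ℕ+ → ℂ := fun n => Complex.exp (-Complex.I * (lam n : ℂ) * (t : ℂ)) with he
    have hne : ∀ n, ‖e n‖ = 1 := fun n => norm_exp_frequency _ _
    have hsub : Finset.Icc 1 N ⊆ Finset.Iio M := fun n hn =>
      Finset.mem_Iio.2 ((Finset.mem_Icc.1 hn).2.trans_lt hNM)
    have hsdiff : Finset.Iio M \ Finset.Icc 1 N = Finset.Ioo N M := by
      ext n
      simp only [Finset.mem_sdiff, Finset.mem_Iio, Finset.mem_Icc, Finset.mem_Ioo,
        one_le, true_and, not_le]
      exact and_comm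
    have hsplit : ∑ n ∈ F, (m (lam n) : ℂ) * ((w n * bohr 𝒢 f n : ℂ) * e n) =
        ∑ n ∈ Finset.Icc 1 N, (w n * bohr 𝒢 f n : ℂ) * e n +
          ∑ n ∈ Finset.Ioo N M, (m (lam n) : ℂ) * ((w n * bohr 𝒢 f n : ℂ) * e n) := by
      rw [← Finset.sum_subset hKF, ← Finset.sum_sdiff hsub, hsdiff, add_comm]
      · congr 1
        refine Finset.sum_congr rfl fun n hn => ?_
        have : m (lam n) = 1 :=
          h1 _ (lam.nonneg n) (lam.strictMono.monotone (Finset.mem_Icc.1 hn).2)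
        rw [this, Complex.ofReal_one, one_mul]
      · intro n _ hn
        have hMn : M ≤ n := by simpa using hn
        have : m (lam n) = 0 := h0 _ (lam.strictMono.monotone hMn)
        rw [this, Complex.ofReal_zero, zero_mul]
    have hmid : ‖∑ n ∈ Finset.Ioo N M, (m (lam n) : ℂ) * ((w n * bohr 𝒢 f n : ℂ) * e n)‖ ≤
        ((M : ℝ) - (N : ℝ) - 1) * ‖f‖ := by
      rw [← card_Ioo_pnat hNM, ← nsmul_eq_mul]
      refine norm_sum_le_of_le _ (fun n _ => ?_) |>.trans_eq (Finset.sum_const _)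
      rw [norm_mul, norm_mul, norm_mul, hne, mul_one, Complex.norm_real, Complex.norm_real,
        Real.norm_eq_abs, Real.norm_of_nonneg (hw n).1]
      calc _ ≤ 1 * (1 * ‖f‖) := by
            gcongr
            · exact mul_nonneg (hw n).1 (norm_nonneg _)
            · exact hle _ (lam.nonneg n)
            · exact (hw n).2
            · exact norm_bohr_le 𝒢 f n
        _ = _ := by ring
    have hdiff : ‖∑ n ∈ Finset.Icc 1 N, ((1 - w n : ℝ) : ℂ) * (bohr 𝒢 f n * e n)‖ ≤
        ε * (N * ‖f‖) := by
      have hc : (N : ℝ) = ((Finset.Icc 1 N).card : ℝ) := by simp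
      rw [hc, mul_left_comm, ← nsmul_eq_mul]
      refine norm_sum_le_of_le _ (fun n hn => ?_) |>.trans_eq (Finset.sum_const _)
      rw [norm_mul, norm_mul, hne, mul_one, Complex.norm_real,
        Real.norm_of_nonneg (by linarith [(hw n).2])]
      gcongr
      · linarith [hwK n (hsub hn)]
      · exact norm_bohr_le 𝒢 f n
    have hdecomp : ∑ n ∈ Finset.Icc 1 N, bohr 𝒢 f n * e n =
        ∑ n ∈ F, (m (lam n) : ℂ) * ((w n * bohr 𝒢 f n : ℂ) * e n) -
          ∑ n ∈ Finset.Ioo N M, (m (lam n) : ℂ) * ((w n * bohr 𝒢 f n : ℂ) * e n) +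
          ∑ n ∈ Finset.Icc 1 N, ((1 - w n : ℝ) : ℂ) * (bohr 𝒢 f n * e n) := by
      rw [hsplit, add_sub_cancel_right, ← Finset.sum_add_distrib]
      refine Finset.sum_congr rfl fun n _ => ?_
      push_cast
      ring
    rw [hdecomp]
    refine (norm_add_le _ _).trans ?_
    have := norm_sub_le (∑ n ∈ F, (m (lam n) : ℂ) * ((w n * bohr 𝒢 f n : ℂ) * e n))
      (∑ n ∈ Finset.Ioo N M, (m (lam n) : ℂ) * ((w n * bohr 𝒢 f n : ℂ) * e n))
    rw [add_mul]
    linarith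
  -- The set `F` and the weights depend on `ε`, but they have disappeared from the estimate `key`,
  -- so `ε → 0` is harmless.
  have hlim : Tendsto (fun ε : ℝ => ((∫ u in Set.Ioi (0 : ℝ), |k u|) +
      ((M : ℝ) - (N : ℝ) - 1)) * ‖f‖ + ε * (N * ‖f‖)) (𝓝[>] 0)
      (𝓝 (((∫ u in Set.Ioi (0 : ℝ), |k u|) + ((M : ℝ) - (N : ℝ) - 1)) * ‖f‖)) := by
    refine Tendsto.mono_left ?_ nhdsWithin_le_nhds
    exact Continuous.tendsto' (by fun_prop) _ _ (by simp)
  exact ge_of_tendsto hlim (eventually_nhdsWithin_of_forall fun ε hε => key ε hε)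

end GeneralDirichlet

theorem mainTheorem11 (lam : GeneralDirichlet.Frequency) :
    ∃ C : ℝ, 0 < C ∧
      ∀ (G : Type u) [CommGroup G] [TopologicalSpace G] [IsTopologicalGroup G]
        [CompactSpace G] [T2Space G] [MeasurableSpace G] [BorelSpace G]
        (𝒢 : GeneralDirichlet.DirichletGroup lam G) (N M : ℕ+), N < M →
        ‖GeneralDirichlet.partialSumOp 𝒢 N‖ ≤
          C * (Real.log ((lam M + lam N) / (lam M - lam N)) + ((M : ℝ) - (N : ℝ) - 1) + 1) := by
  obtain ⟨C, hC, hker⟩ := GeneralDirichlet.exists_trapezoid_kernel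
  refine ⟨C, by linarith, fun G _ _ _ _ _ _ _ 𝒢 N M hNM => ?_⟩
  have hlt : lam N < lam M := lam.strictMono hNM
  obtain ⟨k, hk, hkC, h1, h0, hle⟩ := hker _ _ (lam.nonneg N) hlt
  have hgap : 0 ≤ (M : ℝ) - (N : ℝ) - 1 := by
    rw [← GeneralDirichlet.card_Ioo_pnat hNM]
    positivity
  -- Here `C ≥ 1` and `M - N - 1 ≥ 0` are used.
  have hbound : (∫ u in Set.Ioi (0 : ℝ), |k u|) + ((M : ℝ) - (N : ℝ) - 1) ≤
      C * (Real.log ((lam M + lam N) / (lam M - lam N)) + ((M : ℝ) - (N : ℝ) - 1) + 1) := by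
    nlinarith
  have hknn : 0 ≤ ∫ u in Set.Ioi (0 : ℝ), |k u| := integral_nonneg fun u => abs_nonneg _
  refine ContinuousLinearMap.opNorm_le_bound _ ((add_nonneg hknn hgap).trans hbound) fun f => ?_
  rw [GeneralDirichlet.DInfty.norm_def, GeneralDirichlet.coeff_partialSumOp]
  refine ciSup_le fun s => ?_
  rw [GeneralDirichlet.evalSum_eq (GeneralDirichlet.tendsto_truncate lam _ N s)]
  refine (GeneralDirichlet.norm_evalPartial_le_of_imaginary_axis lam _ N (fun t =>
    GeneralDirichlet.norm_partialSum_le_of_kernel 𝒢 f hNM hk h1 h0 hle t) s.2).trans ?_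
  gcongr
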